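/- Let $b=b(x,t)$ be a continuously differentiable and bounded function on $\mathbb R\times[0,\infty)$, let $1\le p_0<\infty$ and $u_0\in L^{p_0}(\mathbb R)\cap L^\infty(\mathbb R)$. Let $u:\mathbb R\times[0,\infty)\to\mathbb R$ be a solution of $$u_t+(b(x,t)\,u)_x=u_{xx}\quad (x\in\mathbb R,\ t>0),\qquad u(\cdot,0)=u_0,$$ that is: $u$ is bounded on $\mathbb R\times[0,T]$ for every $T>0$; $u,u_t,u_x,u_{xx}$ exist and are continuous on $\mathbb R\times(0,\infty)$ and satisfy the equation there; $u(\cdot,0)=u_0$ almost everywhere; and $u(\cdot,t)\to u_0$ in $L^1_{\rm loc}(\mathbb R)$ as $t\to0^+$. Put $$B(t)=\tfrac12\Big(\sup_{x\in\mathbb R}b(x,t)-\inf_{x\in\mathbb R}b(x,t)\Big),\qquad \mathcal B=\limsup_{t\to\infty}B(t),\qquad C_2=\Big(\frac{3\sqrt3}{4\pi}\Big)^{1/3}.$$ Then, for every real $q\ge 2p_0$, $$\limsup_{t\to\infty}\|u(\cdot,t)\|_{L^q(\mathbb R)}\ \le\ \Big(\frac q2\,C_2^3\Big)^{1/q}\,\mathcal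 B^{1/q}\,\limsup_{t\to\infty}\|u(\cdot,t)\|_{L^{q/2}(\mathbb R)},$$ where the upper limits are taken in $[0,\infty]$ and, on the right-hand side, $0\cdot\infty=\infty$. -/

import Mathlib

open Filter Topology MeasureTheory Set
open scoped ENNReal

noncomputable section

namespace AdvDiff

/-- An admissible advection field `b = b(x,t)`: continuously differentiable and bounded on
`ℝ × [0, ∞)`.  Values at negative times play no role. -/
structure IsAdvectionField (b : ℝ → ℝ → ℝ) : Prop where
  contDiffOn : ContDiffOn ℝ 1 (fun z : ℝ × ℝ => b z.1 z.2) (univ ×ˢ Ici 0)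
  bounded : ∃ M : ℝ, ∀ x t : ℝ, 0 ≤ t → |b x t| ≤ M

/-- `u = u(x,t)` is a (global) solution of
`u_t + (b(x,t) u)_x = u_xx` for `x ∈ ℝ`, `t > 0`, with `u(·,0) = u₀`: it is bounded on every strip
`ℝ × [0, T]`, of class `C²` in `x` and `C¹` in `t` on `ℝ × (0, ∞)` (that is, `u`, `u_t`, `u_x` and
`u_xx` exist and are continuous there), satisfies the equation pointwise there, and attains the
initial value in the sense of `L¹_loc(ℝ)`. -/
structure IsSolution (b : ℝ → ℝ → ℝ) (u₀ : ℝ → ℝ) (u : ℝ → ℝ → ℝ) : Prop where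
  bounded_strip : ∀ T : ℝ, 0 < T → ∃ M : ℝ, ∀ x : ℝ, ∀ t ∈ Icc (0 : ℝ) T, |u x t| ≤ M
  differentiable_time : ∀ x t : ℝ, 0 < t → DifferentiableAt ℝ (fun s => u x s) t
  contDiff_space : ∀ t : ℝ, 0 < t → ContDiff ℝ 2 (fun x => u x t)
  continuousOn_u : ContinuousOn (fun z : ℝ × ℝ => u z.1 z.2) (univ ×ˢ Ioi 0)
  continuousOn_u_t :
    ContinuousOn (fun z : ℝ × ℝ => deriv (fun s => u z.1 s) z.2) (univ ×ˢ Ioi 0)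
  continuousOn_u_x :
    ContinuousOn (fun z : ℝ × ℝ => deriv (fun y => u y z.2) z.1) (univ ×ˢ Ioi 0)
  continuousOn_u_xx :
    ContinuousOn (fun z : ℝ × ℝ => deriv (deriv (fun y => u y z.2)) z.1) (univ ×ˢ Ioi 0)
  equation : ∀ x t : ℝ, 0 < t →
    deriv (fun s => u x s) t + deriv (fun y => b y t * u y t) x
      = deriv (deriv (fun y => u y t)) x
  initial_eq : ∀ᵐ x : ℝ, u x 0 = u₀ x
  initial_limit : ∀ K : Set ℝ, IsCompact K →
    Tendsto (fun t : ℝ => eLpNorm (fun x => u x t - u₀ x) 1 (volume.restrict K))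
      (𝓝[>] 0) (𝓝 0)

/-- `B(t) = (sup_x b(x,t) - inf_x b(x,t)) / 2`. -/
def halfOsc (b : ℝ → ℝ → ℝ) (t : ℝ) : ℝ :=
  (1 / 2) * ((⨆ x : ℝ, b x t) - ⨅ x : ℝ, b x t)

/-- `𝓑 = limsup_{t → ∞} B(t)`. -/
def limsupHalfOsc (b : ℝ → ℝ → ℝ) : ℝ≥0∞ :=
  limsup (fun t : ℝ => ENNReal.ofReal (halfOsc b t)) atTop

/-- `limsup_{t → ∞} ‖u(·,t)‖_{L^r(ℝ)}` as an element of `[0, ∞]`. -/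
def limsupNorm (u : ℝ → ℝ → ℝ) (r : ℝ) : ℝ≥0∞ :=
  limsup (fun t : ℝ => eLpNorm (fun x => u x t) (ENNReal.ofReal r) volume) atTop

/-- `C₂ = (3√3 / (4π))^{1/3}`. -/
def nashConst : ℝ := (3 * √3 / (4 * Real.pi)) ^ (1 / 3 : ℝ)

/-- Multiplication on `[0, ∞]` with the convention `0 · ∞ = ∞ · 0 = ∞`
(Mathlib's product has `0 * ∞ = 0`). -/
def mulTop (a c : ℝ≥0∞) : ℝ≥0∞ :=
  if (a = 0 ∧ c = ∞) ∨ (a = ∞ ∧ c = 0) then ∞ else a * c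

end AdvDiff

end

/-! Write `y(t) = ∫ |u|^q` and test the equation with `q u |u|^(q-2)`. A constant may be subtracted
from `b`, since it contributes only a total `x`-derivative; with the midpoint of the range of
`b(·,t)` the remaining field is at most `B` in modulus. Young's inequality spends half of the
dissipation on the drift term. In `v = u |u|^(q/2-1)` the other half is `(2(q-1)/q) ∫ v_x²`, while
`∫ v² = y` and `∫ |v| = ∫ |u|^(q/2) ≤ N`. Nash's inequality with its sharp constant then yields `y'
≤ (q(q-1)/2) y (B² - 64π² y² / (27 q² N⁴))`, so `y` falls at a definite rate above `(3√3 q/(8π)) B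
N² = (q/2) C₂³ B N²`. With `N = n^(q/2)` a `q`-th root gives the claim. Since decay of `u_x` at
infinity is not known, the computation is done with a cutoff (`localized_energy_le`), arranged so
that the errors involve only `|u|^q`; `eventually_integral_le` removes the cutoff.

The sharp Nash inequality comes from a level-set argument: pick `s` so that `{|f| > s}` has measure
`L`, apply Wirtinger's inequality with period `L` to the part of `f` beyond that level, bound `f²`
by `s|f|` elsewhere, and optimize in `L`. A smoothed indicator `w` replaces the level set, and the
change of variable `dy = w dx` gives total length exactly `L`. -/

/-! ### Wirtinger's inequality, periodic and weighted. -/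

/-- **Wirtinger's inequality** for a `C¹` function on `[a, b]` with equal boundary values. -/
theorem wirtinger_periodic {a b : ℝ} (hab : a < b) {f f' : ℝ → ℝ}
    (hf : ∀ x, HasDerivAt f (f' x) x) (hf' : Continuous f') (hfab : f a = f b) :
    ∫ x in a..b, f x ^ 2 ≤
      ((b - a) / (2 * Real.pi)) ^ 2 * (∫ x in a..b, f' x ^ 2) + (∫ x in a..b, f x) ^ 2 / (b - a) := by
  have hfc : Continuous f := continuous_iff_continuousAt.2 fun x => (hf x).continuousAt
  have hL : 0 < b - a := sub_pos.2 hab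
  have memLp : ∀ g : ℝ → ℝ, Continuous g →
      MemLp (fun x => (g x : ℂ)) 2 (volume.restrict (Ioc a b)) := fun g hg =>
    (memLp_two_iff_integrable_sq_norm
      (Complex.continuous_ofReal.comp hg).aestronglyMeasurable).2
      (((Complex.continuous_ofReal.comp hg).norm.pow 2).integrableOn_Ioc)
  have h1 := hasSum_sq_fourierCoeffOn hab (memLp f hfc)
  have h2 := hasSum_sq_fourierCoeffOn hab (memLp f' hf')
  have h0 : fourierCoeffOn hab (fun x => (f x : ℂ)) 0 = (((b - a)⁻¹ * ∫ x in a..b, f x : ℝ) : ℂ) := by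
    rw [fourierCoeffOn_eq_integral]
    simp only [neg_zero, fourier_zero, one_smul, intervalIntegral.integral_ofReal, one_div,
      Complex.real_smul, Complex.ofReal_mul]
  set m : ℝ := (b - a)⁻¹ * ∫ x in a..b, f x with hm
  -- Parseval is compared mode by mode: the zero mode of `f` is its mean, and every other mode is
  -- controlled by the same mode of `f'`.
  have h3 : HasSum (fun i : ℤ => if i = 0 then m ^ 2 else 0) (m ^ 2) := hasSum_ite_eq 0 (m ^ 2)
  have h4 := h3.add (h2.mul_left (((b - a) / (2 * Real.pi)) ^ 2))
  have key := hasSum_le (fun i => ?_) h1 h4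
  · simp only [Complex.norm_real, Real.norm_eq_abs, sq_abs, smul_eq_mul] at key
    have := mul_le_mul_of_nonneg_left key hL.le
    rw [← mul_assoc, mul_inv_cancel₀ hL.ne', one_mul] at this
    refine this.trans (le_of_eq ?_)
    rw [hm]
    field_simp
    ring
  · by_cases hi : i = 0
    · subst hi
      simp only [h0, if_true, Complex.norm_real, Real.norm_eq_abs, sq_abs]
      have : 0 ≤ ((b - a) / (2 * Real.pi)) ^ 2 *
        ‖fourierCoeffOn hab (fun x => (f' x : ℂ)) 0‖ ^ 2 := by positivity
      linarith
    -- Equal boundary values kill the boundary term of the integration by parts; what remains is the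
    -- factor `(b - a) / (2π i)` for mode `i`, and `|i| ≥ 1`.
    · rw [fourierCoeffOn_of_hasDerivAt hab hi (fun x _ => (hf x).ofReal_comp)
        ((Complex.continuous_ofReal.comp hf').intervalIntegrable _ _), if_neg hi, hfab]
      simp only [sub_self, mul_zero, zero_sub, zero_add]
      rw [← Complex.ofReal_sub]
      simp only [norm_mul, norm_div, norm_neg, norm_one, Complex.norm_real, Complex.norm_I, mul_one,
        Real.norm_eq_abs, Complex.norm_ofNat, abs_of_pos hL, abs_of_pos Real.pi_pos,
        Complex.norm_intCast]
      have hi1 : (1 : ℝ) ≤ |(i : ℝ)| := by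
        exact_mod_cast Int.one_le_abs hi
      rw [← mul_pow]
      refine pow_le_pow_left₀ (by positivity) ?_ 2
      rw [← mul_assoc]
      refine mul_le_mul_of_nonneg_right ?_ (norm_nonneg _)
      rw [one_div, inv_mul_eq_div]
      have := Real.pi_pos
      exact div_le_div_of_nonneg_left hL.le (by positivity) (by nlinarith)

/-- Wirtinger's inequality after the change of variables `dy = w dx`. -/
theorem wirtinger_weighted {a b : ℝ} (hab : a < b) {w p G : ℝ → ℝ} {ε : ℝ} (hε : 0 < ε)
    (hw : Continuous w) (hwε : ∀ x, ε ≤ w x) (hp : Continuous p)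
    (hG : ∀ x, HasDerivAt G (w x * p x) x) (hGab : G a = G b) :
    ∫ x in a..b, w x * G x ^ 2 ≤
      ((∫ x in a..b, w x) / (2 * Real.pi)) ^ 2 * (∫ x in a..b, w x * p x ^ 2)
        + (∫ x in a..b, w x * G x) ^ 2 / (∫ x in a..b, w x) := by
  have hwi : ∀ c d, IntervalIntegrable w volume c d := fun c d => hw.intervalIntegrable c d
  set y : ℝ → ℝ := fun x => ∫ t in a..x, w t with hy
  have hyd : ∀ x, HasDerivAt y (w x) x := fun x =>
    intervalIntegral.integral_hasDerivAt_right (hwi _ _)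
      hw.stronglyMeasurable.stronglyMeasurableAtFilter hw.continuousAt
  have hyc : Continuous y := continuous_iff_continuousAt.2 fun x => (hyd x).continuousAt
  have hgrow : ∀ c d, c ≤ d → ε * (d - c) ≤ y d - y c := by
    intro c d hcd
    have : y d - y c = ∫ t in c..d, w t := by
      simp only [hy]
      rw [intervalIntegral.integral_interval_sub_left (hwi _ _) (hwi _ _)]
    rw [this]
    calc ε * (d - c) = ∫ _ in c..d, ε := by simp [mul_comm]
      _ ≤ _ := intervalIntegral.integral_mono_on hcd (by simp) (hwi _ _) fun x _ => hwε x
  have hmono : StrictMono y := fun c d hcd => by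
    have := hgrow c d hcd.le
    have h2 : 0 < ε * (d - c) := mul_pos hε (sub_pos.2 hcd)
    linarith
  have hsurj : Function.Surjective y := by
    refine hyc.surjective ?_ ?_
    · refine tendsto_atTop.2 fun C => ?_
      filter_upwards [eventually_ge_atTop (max 0 ((C - y 0) / ε))] with x hx
      have h1 := hgrow 0 x ((le_max_left _ _).trans hx)
      have h2 := (div_le_iff₀ hε).1 ((le_max_right _ _).trans hx)
      linarith
    · refine tendsto_atBot.2 fun C => ?_
      filter_upwards [eventually_le_atBot (min 0 ((C - y 0) / ε))] with x hx
      have h1 := hgrow x 0 (hx.trans (min_le_left _ _))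
      have h2 := (le_div_iff₀ hε).1 (hx.trans (min_le_right _ _))
      linarith
  set e := StrictMono.orderIsoOfSurjective y hmono hsurj with he
  have hey : ∀ x, e.symm (y x) = x := fun x => e.symm_apply_apply x
  have hye : ∀ t, y (e.symm t) = t := fun t => e.apply_symm_apply t
  have hzc : Continuous e.symm := e.symm.continuous
  have hw0 : ∀ x, w x ≠ 0 := fun x => (hε.trans_le (hwε x)).ne'
  have hzd : ∀ t, HasDerivAt e.symm (w (e.symm t))⁻¹ t := fun t =>
    HasDerivAt.of_local_left_inverse hzc.continuousAt (hyd _) (hw0 _) (Eventually.of_forall hye)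
  have hGc : Continuous G := continuous_iff_continuousAt.2 fun x => (hG x).continuousAt
  -- The weight in `G' = w p` cancels the derivative `1/w` of the inverse change of variable.
  have hkd : ∀ t, HasDerivAt (fun t => G (e.symm t)) (p (e.symm t)) t := fun t => by
    have := (hG (e.symm t)).comp t (hzd t)
    rwa [mul_comm, ← mul_assoc, inv_mul_cancel₀ (hw0 _), one_mul] at this
  have hya : y a = 0 := by simp [hy]
  have hW := wirtinger_periodic (hmono hab) hkd (hp.comp hzc) (by simp only [hey]; exact hGab)
  have cv : ∀ g : ℝ → ℝ, Continuous g →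
      ∫ t in y a..y b, g (e.symm t) = ∫ x in a..b, w x * g x := fun g hg => by
    refine (intervalIntegral.integral_comp_mul_deriv (fun x _ => hyd x) hw.continuousOn
      (hg.comp hzc)).symm.trans ?_
    refine intervalIntegral.integral_congr fun x _ => ?_
    simp [hey, mul_comm]
  rw [cv (fun x => G x ^ 2) (by fun_prop), cv (fun x => p x ^ 2) (by fun_prop), cv G hGc, hya,
    sub_zero] at hW
  exact hW

/-! ### Smoothed level sets. -/

/-- A continuous ramp: `1` above level `s`, `ε` well below it, always between `ε` and `1`. -/
noncomputable def levelRamp (ε s v : ℝ) : ℝ := max ε (min 1 ((v - s) / ε + 1))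

theorem le_levelRamp (ε s v : ℝ) : ε ≤ levelRamp ε s v := le_max_left _ _

theorem levelRamp_le_one {ε : ℝ} (hε : ε ≤ 1) (s v : ℝ) : levelRamp ε s v ≤ 1 :=
  max_le hε (min_le_left _ _)

theorem levelRamp_eq_one {ε s v : ℝ} (hε : 0 < ε) (hε1 : ε ≤ 1) (h : s ≤ v) :
    levelRamp ε s v = 1 := by
  unfold levelRamp
  rw [min_eq_left, max_eq_right hε1]
  have : 0 ≤ (v - s) / ε := div_nonneg (sub_nonneg.2 h) hε.le
  linarith

theorem levelRamp_eq_of_le {ε s v : ℝ} (hε : 0 < ε) (h : v ≤ s - ε) :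
    levelRamp ε s v = ε := by
  unfold levelRamp
  rw [max_eq_left]
  refine (min_le_right _ _).trans ?_
  have : (v - s) / ε ≤ -1 := by rw [div_le_iff₀ hε]; linarith
  linarith

/-- Either the ramp equals `ε` and the gap is at most `C`, or the gap is at most `ε` and the ramp at
most `1`. This makes the error of smoothing the level set vanish with `ε`. -/
theorem levelRamp_mul_sub_le {ε s v C : ℝ} (hε : 0 < ε) (hε1 : ε ≤ 1) (hv : 0 ≤ v)
    (hs : s ≤ C) (hC : 1 ≤ C) (h : v ≤ s) : levelRamp ε s v * (s - v) ≤ ε * C := by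
  rcases le_total v (s - ε) with h1 | h1
  · rw [levelRamp_eq_of_le hε h1]
    nlinarith
  · have h2 := levelRamp_le_one hε1 s v
    have h3 : 0 ≤ levelRamp ε s v := hε.le.trans (le_levelRamp _ _ _)
    nlinarith

/-- The odd primitive of `v ↦ levelRamp ε s |v|`. -/
noncomputable def levelPrim (ε s v : ℝ) : ℝ := ∫ t in (0 : ℝ)..v, levelRamp ε s |t|

theorem continuous_levelRamp_abs (ε s : ℝ) : Continuous fun t : ℝ => levelRamp ε s |t| := by
  unfold levelRamp
  fun_prop

theorem hasDerivAt_levelPrim (ε s v : ℝ) : HasDerivAt (levelPrim ε s) (levelRamp ε s |v|) v :=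
  intervalIntegral.integral_hasDerivAt_right ((continuous_levelRamp_abs ε s).intervalIntegrable _ _)
    (continuous_levelRamp_abs ε s).stronglyMeasurable.stronglyMeasurableAtFilter
    (continuous_levelRamp_abs ε s).continuousAt

theorem levelPrim_neg (ε s v : ℝ) : levelPrim ε s (-v) = -levelPrim ε s v := by
  unfold levelPrim
  have := intervalIntegral.integral_comp_neg (a := 0) (b := v) fun t : ℝ => levelRamp ε s |t|
  simp only [abs_neg, neg_zero] at this
  rw [this, intervalIntegral.integral_symm]

theorem levelPrim_nonneg {ε s v : ℝ} (hε : 0 < ε) (hv : 0 ≤ v) : 0 ≤ levelPrim ε s v :=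
  intervalIntegral.integral_nonneg hv fun _ _ => hε.le.trans (le_levelRamp _ _ _)

theorem abs_levelPrim {ε s v : ℝ} (hε : 0 < ε) : |levelPrim ε s v| = levelPrim ε s |v| := by
  rcases le_total 0 v with h | h
  · rw [abs_of_nonneg h, abs_of_nonneg (levelPrim_nonneg hε h)]
  · rw [abs_of_nonpos h, levelPrim_neg, abs_of_nonpos]
    have := levelPrim_nonneg (s := s) hε (neg_nonneg.2 h)
    rw [levelPrim_neg] at this
    linarith

theorem levelPrim_sub (ε s v w : ℝ) :
    levelPrim ε s w - levelPrim ε s v = ∫ t in v..w, levelRamp ε s |t| :=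
  intervalIntegral.integral_interval_sub_left
    ((continuous_levelRamp_abs ε s).intervalIntegrable _ _)
    ((continuous_levelRamp_abs ε s).intervalIntegrable _ _)

/-- The primitive has slope `1` above `s` and slope in `[0, 1]` below. Shifted by `s - levelPrim ε s
s`, it therefore agrees with `v` above the level and lies between `v` and `s` below it. -/
theorem levelPrim_sub_of_le {ε s v : ℝ} (hε : 0 < ε) (hε1 : ε ≤ 1) (h : s ≤ v) :
    levelPrim ε s v - levelPrim ε s s = v - s := by
  rw [levelPrim_sub]
  calc ∫ t in s..v, levelRamp ε s |t| = ∫ t in s..v, (1 : ℝ) := by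
        refine intervalIntegral.integral_congr fun t ht => ?_
        rw [uIcc_of_le h] at ht
        exact levelRamp_eq_one hε hε1 (ht.1.trans (le_abs_self t))
    _ = v - s := by simp

theorem levelPrim_sub_mem {ε s v : ℝ} (hε : 0 < ε) (hε1 : ε ≤ 1) (h : v ≤ s) :
    0 ≤ levelPrim ε s s - levelPrim ε s v ∧ levelPrim ε s s - levelPrim ε s v ≤ s - v := by
  rw [levelPrim_sub]
  refine ⟨intervalIntegral.integral_nonneg h fun _ _ => hε.le.trans (le_levelRamp _ _ _), ?_⟩
  calc ∫ t in v..s, levelRamp ε s |t| ≤ ∫ t in v..s, (1 : ℝ) :=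
        intervalIntegral.integral_mono_on h
          ((continuous_levelRamp_abs ε s).intervalIntegrable _ _) (by simp)
          fun t _ => levelRamp_le_one hε1 _ _
    _ = s - v := by simp

/-! ### Nash's inequality with the sharp constant. -/

/-- Nash's inequality in additive form, up to an error of size `ε`, on a symmetric interval. -/
theorem nash_interval_approx {f f' : ℝ → ℝ} {K M L ε : ℝ} (hf : ∀ x, HasDerivAt f (f' x) x)
    (hf' : Continuous f') (hK : f (-K) = f K) (hM : ∀ x, |f x| ≤ M) (hL : 0 < L)
    (hLK : L ≤ 2 * K) (hε : 0 < ε) (hε1 : ε < 1) (hεL : 2 * K * ε ≤ L) :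
    ∫ x in (-K)..K, f x ^ 2 ≤ (L / (2 * Real.pi)) ^ 2 * (∫ x in (-K)..K, f' x ^ 2)
      + ((∫ x in (-K)..K, |f x|) + 2 * K * (ε * (M + 1))) ^ 2 / L := by
  have hK0 : -K < K := by linarith
  have hM0 : 0 ≤ M := (abs_nonneg _).trans (hM 0)
  have hfc : Continuous f := continuous_iff_continuousAt.2 fun x => (hf x).continuousAt
  -- The level is found by the intermediate value theorem: the total weight is `2K ≥ L` at `s = 0`
  -- and `2Kε ≤ L` at `s = M + 1`, where the ramp is flat because `|f| ≤ M ≤ s - ε`.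
  obtain ⟨s, hs, hsL⟩ : ∃ s ∈ Icc 0 (M + 1), ∫ x in (-K)..K, levelRamp ε s |f x| = L := by
    have hc : Continuous fun s => ∫ x in (-K)..K, levelRamp ε s |f x| :=
      intervalIntegral.continuous_parametric_intervalIntegral_of_continuous'
        (by unfold Function.uncurry levelRamp; fun_prop) _ _
    refine intermediate_value_Icc' (by linarith) hc.continuousOn ⟨?_, ?_⟩
    · have : ∀ x, levelRamp ε (M + 1) |f x| = ε := fun x =>
        levelRamp_eq_of_le hε (by have := hM x; linarith)
      simp only [this, intervalIntegral.integral_const, smul_eq_mul]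
      linarith
    · have : ∀ x, levelRamp ε 0 |f x| = 1 := fun x =>
        levelRamp_eq_one hε hε1.le (abs_nonneg _)
      simp only [this, intervalIntegral.integral_const, smul_eq_mul]
      linarith
  set w : ℝ → ℝ := fun x => levelRamp ε s |f x| with hw
  have hwc : Continuous w := by rw [hw]; unfold levelRamp; fun_prop
  have hwε : ∀ x, ε ≤ w x := fun x => le_levelRamp _ _ _
  have hw1 : ∀ x, w x ≤ 1 := fun x => levelRamp_le_one hε1.le _ _
  set G : ℝ → ℝ := fun x => levelPrim ε s (f x) with hG
  have hGd : ∀ x, HasDerivAt G (w x * f' x) x := fun x => (hasDerivAt_levelPrim ε s (f x)).comp x (hf x)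
  have hGc : Continuous G := continuous_iff_continuousAt.2 fun x => (hGd x).continuousAt
  have hW := wirtinger_weighted hK0 hε hwc hwε hf' hGd (by simp only [hG, hK])
  have hwL : ∫ x in (-K)..K, w x = L := hsL
  rw [hwL] at hW
  have ii : ∀ {g : ℝ → ℝ}, Continuous g → IntervalIntegrable g volume (-K) K :=
    fun hg => hg.intervalIntegrable _ _
  set c : ℝ := s - levelPrim ε s s with hcdef
  set e : ℝ := ε * (M + 1) with he
  -- pointwise comparison of `X = |G| + c` with `|f|`
  have hX : ∀ x, |f x| ≤ |G x| + c ∧ w x * (|G x| + c) ≤ w x * |f x| + e ∧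
      (1 - w x) * |f x| ^ 2 ≤ s * ((1 - w x) * |f x|) ∧ s * w x ≤ w x * |f x| + e := by
    intro x
    have hGx : |G x| = levelPrim ε s |f x| := abs_levelPrim hε
    have hv : 0 ≤ |f x| := abs_nonneg _
    have he0 : 0 ≤ e := by positivity
    have hwx : 0 ≤ w x := hε.le.trans (hwε x)
    rw [hGx]
    rcases le_total s |f x| with h | h
    · have h1 := levelPrim_sub_of_le hε hε1.le h
      have h2 : w x = 1 := levelRamp_eq_one hε hε1.le h
      rw [h2]
      refine ⟨by linarith, by linarith, by simp, by linarith⟩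
    · have h1 := levelPrim_sub_mem hε hε1.le h
      have h2 : w x * (s - |f x|) ≤ e :=
        levelRamp_mul_sub_le hε hε1.le hv hs.2 (by linarith) h
      refine ⟨by linarith, ?_, ?_, by linarith⟩
      · have := mul_le_mul_of_nonneg_left h1.1 hwx
        have h3 : w x * c = w x * s - w x * levelPrim ε s s := by rw [hcdef]; ring
        linarith
      · have := mul_le_mul_of_nonneg_left h (mul_nonneg (sub_nonneg.2 (hw1 x)) hv)
        linarith
  set D := ∫ x in (-K)..K, f' x ^ 2 with hD
  set m := ∫ x in (-K)..K, |f x| with hm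
  set P := ∫ x in (-K)..K, w x * |f x| with hP
  set A := ∫ x in (-K)..K, w x * |G x| with hA
  have hint : ∀ (g h : ℝ → ℝ), Continuous g → Continuous h → (∀ x, g x ≤ h x) →
      ∫ x in (-K)..K, g x ≤ ∫ x in (-K)..K, h x := fun g h hg hh hgh =>
    intervalIntegral.integral_mono_on hK0.le (ii hg) (ii hh) fun x _ => hgh x
  have hconst : ∫ _ in (-K)..K, e = 2 * K * e := by
    rw [intervalIntegral.integral_const, smul_eq_mul]; ring
  have hwD : ∫ x in (-K)..K, w x * f' x ^ 2 ≤ D :=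
    hint _ _ (by fun_prop) (by fun_prop) fun x =>
      mul_le_of_le_one_left (sq_nonneg _) (hw1 x)
  have hGA : (∫ x in (-K)..K, w x * G x) ^ 2 ≤ A ^ 2 := by
    refine sq_le_sq' ?_ ?_
    · rw [neg_le, ← intervalIntegral.integral_neg]
      refine hint _ _ (by fun_prop) (by fun_prop) fun x => ?_
      have := mul_le_mul_of_nonneg_left (neg_abs_le (G x)) (hε.le.trans (hwε x))
      linarith
    · exact hint _ _ (by fun_prop) (by fun_prop) fun x =>
        mul_le_mul_of_nonneg_left (le_abs_self _) (hε.le.trans (hwε x))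
  have hX2 : ∫ x in (-K)..K, w x * (|G x| + c) ^ 2 =
      (∫ x in (-K)..K, w x * G x ^ 2) + 2 * c * A + c ^ 2 * L := by
    rw [← hwL, hA, ← intervalIntegral.integral_const_mul, ← intervalIntegral.integral_const_mul,
      ← intervalIntegral.integral_add (ii (by fun_prop)) (ii (by fun_prop)),
      ← intervalIntegral.integral_add (ii (by fun_prop)) (ii (by fun_prop))]
    refine intervalIntegral.integral_congr fun x _ => ?_
    rw [← sq_abs (G x)]
    ring
  have hX1 : ∫ x in (-K)..K, w x * (|G x| + c) = A + c * L := by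
    rw [← hwL, hA, ← intervalIntegral.integral_const_mul,
      ← intervalIntegral.integral_add (ii (by fun_prop)) (ii (by fun_prop))]
    refine intervalIntegral.integral_congr fun x _ => ?_
    ring
  have hXP : A + c * L ≤ P + 2 * K * e := by
    rw [← hX1, ← hconst, hP, ← intervalIntegral.integral_add (ii (by fun_prop)) (ii (by fun_prop))]
    exact hint _ _ (by fun_prop) (by fun_prop) fun x => (hX x).2.1
  have hX0 : 0 ≤ A + c * L := by
    rw [← hX1]
    refine intervalIntegral.integral_nonneg hK0.le fun x _ =>
      mul_nonneg (hε.le.trans (hwε x)) ((abs_nonneg _).trans (hX x).1)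
  have hinner : ∫ x in (-K)..K, w x * f x ^ 2 ≤
      (L / (2 * Real.pi)) ^ 2 * D + (P + 2 * K * e) ^ 2 / L := by
    have h1 : ∫ x in (-K)..K, w x * f x ^ 2 ≤ ∫ x in (-K)..K, w x * (|G x| + c) ^ 2 := by
      refine hint _ _ (by fun_prop) (by fun_prop) fun x => ?_
      rw [← sq_abs (f x)]
      exact mul_le_mul_of_nonneg_left (pow_le_pow_left₀ (abs_nonneg _) (hX x).1 2)
        (hε.le.trans (hwε x))
    -- Shifting `|G|` by `c` changes its weighted second moment and its squared mean term by the
    -- same amount, so the Wirtinger bound passes to `|G| + c`, which dominates `|f|`.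
    have h2 : (A + c * L) ^ 2 / L = A ^ 2 / L + 2 * c * A + c ^ 2 * L := by
      field_simp
      ring
    have h3 : (A + c * L) ^ 2 / L ≤ (P + 2 * K * e) ^ 2 / L := by gcongr
    have h4 : (∫ x in (-K)..K, w x * G x) ^ 2 / L ≤ A ^ 2 / L := by gcongr
    have h5 := mul_le_mul_of_nonneg_left hwD (sq_nonneg (L / (2 * Real.pi)))
    linarith
  have houter : ∫ x in (-K)..K, (1 - w x) * f x ^ 2 ≤ s * (m - P) := by
    rw [hm, hP, ← intervalIntegral.integral_sub (ii (by fun_prop)) (ii (by fun_prop)),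
      ← intervalIntegral.integral_const_mul]
    refine hint _ _ (by fun_prop) (by fun_prop) fun x => ?_
    have := (hX x).2.2.1
    rw [sq_abs] at this
    linarith
  have hsP : s * L ≤ P + 2 * K * e := by
    rw [← hwL, ← hconst, hP, ← intervalIntegral.integral_const_mul,
      ← intervalIntegral.integral_add (ii (by fun_prop)) (ii (by fun_prop))]
    exact hint _ _ (by fun_prop) (by fun_prop) fun x => (hX x).2.2.2
  have hPm : P ≤ m := hint _ _ (by fun_prop) (by fun_prop) fun x =>
    mul_le_of_le_one_left (abs_nonneg _) (hw1 x)
  have hP0 : 0 ≤ P := intervalIntegral.integral_nonneg hK0.le fun x _ =>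
    mul_nonneg (hε.le.trans (hwε x)) (abs_nonneg _)
  have hsplit : ∫ x in (-K)..K, f x ^ 2 =
      (∫ x in (-K)..K, w x * f x ^ 2) + ∫ x in (-K)..K, (1 - w x) * f x ^ 2 := by
    rw [← intervalIntegral.integral_add (ii (by fun_prop)) (ii (by fun_prop))]
    refine intervalIntegral.integral_congr fun x _ => ?_
    ring
  have hKe : 0 ≤ 2 * K * e := by
    have : 0 ≤ K := by linarith
    positivity
  -- With `P' = P + 2Ke` and `m' = m + 2Ke`, the bound `s ≤ P'/L` reduces the left side to `P' m' /
  -- L`, and `P' ≤ m'`.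
  have hfin : (P + 2 * K * e) ^ 2 / L + s * (m - P) ≤ (m + 2 * K * e) ^ 2 / L := by
    rw [div_add' _ _ _ hL.ne', div_le_div_iff_of_pos_right hL]
    nlinarith [mul_le_mul_of_nonneg_right hsP (sub_nonneg.2 hPm)]
  linarith

/-- Nash's inequality on `ℝ` with the sharp constant, in additive form. -/
theorem nash_additive {f f' : ℝ → ℝ} {L : ℝ} (hf : ∀ x, HasDerivAt f (f' x) x)
    (hf' : Continuous f') (hfs : HasCompactSupport f) (hL : 0 < L) :
    ∫ x, f x ^ 2 ≤ (L / (2 * Real.pi)) ^ 2 * (∫ x, f' x ^ 2) + (∫ x, |f x|) ^ 2 / L := by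
  have hfc : Continuous f := continuous_iff_continuousAt.2 fun x => (hf x).continuousAt
  obtain ⟨M, hM⟩ := hfs.exists_bound_of_continuous hfc
  obtain ⟨R, hR⟩ := hfs.isCompact.isBounded.subset_closedBall 0
  have hf'd : f' = deriv f := funext fun x => (hf x).deriv.symm
  set K : ℝ := max (|R| + 1) (L / 2) with hKdef
  have hKR : |R| + 1 ≤ K := le_max_left _ _
  have hKL : L / 2 ≤ K := le_max_right _ _
  have hsub : tsupport f ⊆ Ioo (-K) K := fun x hx => by
    have := hR hx
    rw [Metric.mem_closedBall, Real.dist_0_eq_abs] at this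
    exact abs_lt.1 (this.trans_lt ((le_abs_self R).trans_lt (by linarith)))
  have hint : ∀ g : ℝ → ℝ, (∀ x, x ∉ tsupport f → g x = 0) → ∫ x, g x = ∫ x in (-K)..K, g x := by
    intro g hg
    refine (intervalIntegral.integral_eq_integral_of_support_subset fun x hx => ?_).symm
    have : x ∈ tsupport f := by
      by_contra h
      exact hx (hg x h)
    exact Ioo_subset_Ioc_self (hsub this)
  have hzero : ∀ x, x ∉ tsupport f → f x = 0 := fun x hx => image_eq_zero_of_notMem_tsupport hx
  have hzero' : ∀ x, x ∉ tsupport f → f' x = 0 := fun x hx => by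
    rw [hf'd]
    exact image_eq_zero_of_notMem_tsupport fun h => hx (tsupport_deriv_subset h)
  rw [hint _ fun x hx => by rw [hzero x hx]; simp, hint _ fun x hx => by rw [hzero' x hx]; simp,
    hint _ fun x hx => by rw [hzero x hx]; simp]
  have hlim : Tendsto (fun ε : ℝ => (L / (2 * Real.pi)) ^ 2 * (∫ x in (-K)..K, f' x ^ 2)
      + ((∫ x in (-K)..K, |f x|) + 2 * K * (ε * (M + 1))) ^ 2 / L) (𝓝[>] 0)
      (𝓝 ((L / (2 * Real.pi)) ^ 2 * (∫ x in (-K)..K, f' x ^ 2)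
        + ((∫ x in (-K)..K, |f x|) + 2 * K * (0 * (M + 1))) ^ 2 / L)) := by
    refine Tendsto.mono_left (Continuous.tendsto ?_ 0) nhdsWithin_le_nhds
    fun_prop
  simp only [zero_mul, mul_zero, add_zero] at hlim
  have hK0 : 0 < K := by linarith [abs_nonneg R]
  refine ge_of_tendsto hlim ?_
  have h1 : ∀ᶠ ε : ℝ in 𝓝[>] 0, ε < min 1 (L / (2 * K)) :=
    nhdsWithin_le_nhds (Iio_mem_nhds (by positivity))
  filter_upwards [h1, self_mem_nhdsWithin] with ε hε1 hε
  refine nash_interval_approx hf hf' ?_ (fun x => hM x) hL (by linarith) hε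
    (hε1.trans_le (min_le_left _ _)) ?_
  · rw [hzero _ fun h => (hsub h).1.ne rfl, hzero _ fun h => (hsub h).2.ne rfl]
  · have := (lt_div_iff₀ (by positivity)).1 (hε1.trans_le (min_le_right _ _))
    linarith

/-- **Nash's inequality** on `ℝ` with the sharp constant. -/
theorem nash_inequality {f f' : ℝ → ℝ} (hf : ∀ x, HasDerivAt f (f' x) x)
    (hf' : Continuous f') (hfs : HasCompactSupport f) :
    16 * Real.pi ^ 2 * (∫ x, f x ^ 2) ^ 3 ≤ 27 * (∫ x, f' x ^ 2) * (∫ x, |f x|) ^ 4 := by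
  have hfc : Continuous f := continuous_iff_continuousAt.2 fun x => (hf x).continuousAt
  set F := ∫ x, f x ^ 2 with hF
  set D := ∫ x, f' x ^ 2 with hD
  set m := ∫ x, |f x| with hm
  have hD0 : 0 ≤ D := integral_nonneg fun x => sq_nonneg _
  have hm0 : 0 ≤ m := integral_nonneg fun x => abs_nonneg _
  have hF00 : 0 ≤ F := integral_nonneg fun x => sq_nonneg _
  rcases hF00.eq_or_lt with h0 | hF0
  · rw [← h0]
    simp only [ne_eq, OfNat.ofNat_ne_zero, not_false_eq_true, zero_pow, mul_zero]
    positivity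
  have hm1 : 0 < m := by
    refine hm0.lt_of_ne fun h => ?_
    have hae := (integral_eq_zero_iff_of_nonneg (fun x => abs_nonneg (f x))
      (hfc.abs.integrable_of_hasCompactSupport hfs.norm)).1 h.symm
    have : F = 0 := integral_eq_zero_of_ae (hae.mono fun x hx => by
      have : |f x| = 0 := hx
      simp [abs_eq_zero.1 this])
    exact hF0.ne' this
  -- This `L` makes the mass term exactly `2F/3`, the split that holds at the minimum over `L` of an
  -- expression `αL² + β/L` with value `F`.
  have key := nash_additive hf hf' hfs (L := 3 / 2 * m ^ 2 / F) (by positivity)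
  rw [← hF, ← hD, ← hm] at key
  have h1 : m ^ 2 / (3 / 2 * m ^ 2 / F) = 2 / 3 * F := by field_simp
  have h2 : (3 / 2 * m ^ 2 / F / (2 * Real.pi)) ^ 2 * D =
      9 * m ^ 4 * D / (16 * Real.pi ^ 2 * F ^ 2) := by
    field_simp
    ring
  rw [h1, h2] at key
  have h3 : F / 3 ≤ 9 * m ^ 4 * D / (16 * Real.pi ^ 2 * F ^ 2) := by linarith
  rw [le_div_iff₀ (by positivity)] at h3
  nlinarith

/-! ### The localized energy inequality at a fixed time. -/

/-- The factor `z` supplies differentiability at the origin, even for `a = 0`. With `a = q - 2` and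
`a = q/2 - 1` this covers the test function and `v` without separating the zeros of `u`. -/
theorem hasDerivAt_mul_abs_rpow {a : ℝ} (ha : 0 ≤ a) (z : ℝ) :
    HasDerivAt (fun z : ℝ => z * |z| ^ a) ((a + 1) * |z| ^ a) z := by
  rcases eq_or_ne z 0 with rfl | hz
  · rcases ha.eq_or_lt with rfl | ha
    · simpa using hasDerivAt_id' (0 : ℝ)
    · rw [abs_zero, Real.zero_rpow ha.ne', mul_zero, hasDerivAt_iff_tendsto_slope_zero]
      have h : Tendsto (fun t : ℝ => |t| ^ a) (𝓝[≠] 0) (𝓝 (|0| ^ a)) :=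
        Tendsto.mono_left (Continuous.tendsto
          (continuous_abs.rpow_const fun _ => Or.inr ha.le) 0) nhdsWithin_le_nhds
      rw [abs_zero, Real.zero_rpow ha.ne'] at h
      refine h.congr' ?_
      filter_upwards [self_mem_nhdsWithin] with t ht
      have ht' : t ≠ 0 := ht
      simp [ht']
  · have h1 : HasDerivAt (fun z : ℝ => |z|) (SignType.sign z : ℝ) z := hasDerivAt_abs hz
    have h2 := (hasDerivAt_id z).mul (h1.rpow_const (p := a) (Or.inl (abs_ne_zero.2 hz)))
    refine h2.congr_deriv ?_
    have h3 : z * (SignType.sign z : ℝ) = |z| := by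
      rw [mul_comm]; exact sign_mul_self z
    have h4 : |z| ^ a = |z| * |z| ^ (a - 1) := by
      rw [Real.rpow_sub_one (abs_ne_zero.2 hz)]
      field_simp [abs_ne_zero.2 hz]
    simp only [id]
    calc 1 * |z| ^ a + z * ((SignType.sign z : ℝ) * a * |z| ^ (a - 1))
        = |z| ^ a + a * ((z * (SignType.sign z : ℝ)) * |z| ^ (a - 1)) := by ring
      _ = (a + 1) * |z| ^ a := by rw [h3, ← h4]; ring

theorem continuous_abs_rpow {X : Type*} [TopologicalSpace X] {a : ℝ} (ha : 0 ≤ a) {f : X → ℝ}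
    (hf : Continuous f) : Continuous fun x => |f x| ^ a :=
  hf.abs.rpow_const fun _ => Or.inr ha

set_option maxHeartbeats 800000 in
/-- The localized energy inequality at a fixed time, after an application of Nash's inequality. -/
theorem localized_energy_le {q : ℝ} (hq : 2 ≤ q) {U U1 U2 b b1 ψ ψ1 ψ2 : ℝ → ℝ}
    {β B κ N S : ℝ} (hU : ∀ x, HasDerivAt U (U1 x) x) (hU1 : ∀ x, HasDerivAt U1 (U2 x) x)
    (hU2 : Continuous U2) (hb : ∀ x, HasDerivAt b (b1 x) x) (hb1 : Continuous b1)
    (hbB : ∀ x, |b x - β| ≤ B) (hψ : ∀ x, HasDerivAt ψ (ψ1 x) x)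
    (hψ1 : ∀ x, HasDerivAt ψ1 (ψ2 x) x) (hψ2 : Continuous ψ2) (hψc : HasCompactSupport ψ)
    (hψ01 : ∀ x, ψ x ∈ Icc (0 : ℝ) 1) (hκ1 : ∀ x, |ψ1 x| ≤ κ) (hκ2 : ∀ x, |ψ2 x| ≤ κ)
    (hκ : κ ≤ 1) (hN : 0 < N) (hUi : Integrable fun x => |U x| ^ (q / 2))
    (hUN : ∫ x, |U x| ^ (q / 2) ≤ N) (hUq : Integrable fun x => |U x| ^ q)
    (hUS : ∫ x, |U x| ^ q ≤ S) :
    ∫ x, q * (ψ x ^ 2 * (U x * |U x| ^ (q - 2))) * (U2 x - (b1 x * U x + b x * U1 x)) ≤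
      q * (q - 1) / 2 * (∫ x, ψ x ^ 2 * |U x| ^ q) *
          (B ^ 2 - 64 * Real.pi ^ 2 / (27 * q ^ 2 * N ^ 4) * (∫ x, ψ x ^ 2 * |U x| ^ q) ^ 2)
        + (2 * q * B + 2 * |β| + 3) * κ * S := by
  have cont : ∀ {g g1 : ℝ → ℝ}, (∀ x, HasDerivAt g (g1 x) x) → Continuous g := fun h =>
    continuous_iff_continuousAt.2 fun x => (h x).continuousAt
  have cU := cont hU
  have cU1 := cont hU1
  have cb := cont hb
  have cψ := cont hψ
  have cψ1 := cont hψ1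
  have hq2 : 0 ≤ q - 2 := by linarith
  have ha : 0 ≤ q / 2 - 1 := by linarith
  have hq0 : 0 < q := by linarith
  have hκ0 : 0 ≤ κ := (abs_nonneg _).trans (hκ1 0)
  set A : ℝ → ℝ := fun x => |U x| ^ (q - 2) with hA
  have cA : Continuous A := continuous_abs_rpow hq2 cU
  have hA0 : ∀ x, 0 ≤ A x := fun x => Real.rpow_nonneg (abs_nonneg _) _
  have hΦ : ∀ x, |U x| ^ q = A x * U x ^ 2 := fun x => by
    rw [hA, ← sq_abs (U x), ← Real.rpow_two]
    simp only
    rw [← Real.rpow_add_of_nonneg (abs_nonneg _) hq2 zero_le_two]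
    ring_nf
  set E : ℝ → ℝ := fun x => |U x| ^ (q / 2 - 1) with hE
  have cE : Continuous E := continuous_abs_rpow ha cU
  have hEA : ∀ x, E x ^ 2 = A x := fun x => by
    rw [hE, hA]
    simp only
    rw [← Real.rpow_two, ← Real.rpow_mul (abs_nonneg _)]
    ring_nf
  have hEU : ∀ x, |U x * E x| = |U x| ^ (q / 2) := fun x => by
    rw [abs_mul, abs_of_nonneg (Real.rpow_nonneg (abs_nonneg _) _ : 0 ≤ E x)]
    nth_rewrite 1 [← Real.rpow_one |U x|]
    rw [← Real.rpow_add_of_nonneg (abs_nonneg _) zero_le_one ha]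
    ring_nf
  have hUA : ∀ x, HasDerivAt (fun x => U x * A x) ((q - 1) * A x * U1 x) x := fun x => by
    refine ((hasDerivAt_mul_abs_rpow hq2 (U x)).comp x (hU x)).congr_deriv ?_
    rw [hA]; ring
  have hΦd : ∀ x, HasDerivAt (fun x => A x * U x ^ 2) (q * (U x * A x) * U1 x) x := fun x => by
    have h := (hUA x).mul (hU x)
    have h2 : (fun x => A x * U x ^ 2) = (fun x => U x * A x) * U := by
      funext y; simp only [Pi.mul_apply]; ring
    rw [h2]
    refine h.congr_deriv ?_
    ring
  have hv : ∀ x, HasDerivAt (fun x => U x * E x) (q / 2 * E x * U1 x) x := fun x => by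
    refine ((hasDerivAt_mul_abs_rpow ha (U x)).comp x (hU x)).congr_deriv ?_
    rw [hE]; ring
  set f : ℝ → ℝ := fun x => ψ x * (U x * E x) with hf
  set f1 : ℝ → ℝ := fun x => ψ1 x * (U x * E x) + ψ x * (q / 2 * E x * U1 x) with hf1
  have hfd : ∀ x, HasDerivAt f (f1 x) x := fun x => (hψ x).mul (hv x)
  have cf1 : Continuous f1 := by fun_prop
  have hfc : HasCompactSupport f := hψc.mul_right
  have hf1c : HasCompactSupport f1 := by
    have : f1 = deriv f := funext fun x => (hfd x).deriv.symm
    rw [this]; exact hfc.deriv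
  have hfsq : ∀ x, f x ^ 2 = ψ x ^ 2 * |U x| ^ q := fun x => by
    rw [hΦ, ← hEA]; simp only [hf]; ring
  -- the total derivative
  set W : ℝ → ℝ := fun x => q * (ψ x ^ 2 * (U x * A x)) * (U1 x - (b x - β) * U x)
    - β * (ψ x ^ 2 * (A x * U x ^ 2)) - 2 / q * (ψ x * ψ1 x * (A x * U x ^ 2)) with hW
  set W1 : ℝ → ℝ := fun x =>
    q * (2 * ψ x * ψ1 x * (U x * A x) + ψ x ^ 2 * ((q - 1) * A x * U1 x))
        * (U1 x - (b x - β) * U x)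
      + q * (ψ x ^ 2 * (U x * A x)) * (U2 x - (b1 x * U x + (b x - β) * U1 x))
      - β * (2 * ψ x * ψ1 x * (A x * U x ^ 2) + ψ x ^ 2 * (q * (U x * A x) * U1 x))
      - 2 / q * ((ψ1 x ^ 2 + ψ x * ψ2 x) * (A x * U x ^ 2)
          + ψ x * ψ1 x * (q * (U x * A x) * U1 x)) with hW1
  have hψsq : ∀ x, HasDerivAt (fun x => ψ x ^ 2) (2 * ψ x * ψ1 x) x := fun x => by
    refine ((hψ x).pow 2).congr_deriv ?_
    simp
  have hWd : ∀ x, HasDerivAt W (W1 x) x := fun x => by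
    have h1 := (((hψsq x).mul (hUA x)).const_mul q).mul
      ((hU1 x).sub (((hb x).sub_const β).mul (hU x)))
    have h2 := ((hψsq x).mul (hΦd x)).const_mul β
    have h3 := (((hψ x).mul (hψ1 x)).mul (hΦd x)).const_mul (2 / q)
    refine ((h1.sub h2).sub h3).congr_deriv ?_
    simp only [hW1, Pi.mul_apply, Pi.sub_apply]
    ring
  have cW1 : Continuous W1 := by fun_prop
  have hWc : HasCompactSupport W := hψc.mono fun x hx => by
    rw [Function.mem_support] at hx ⊢
    intro h
    exact hx (by simp [hW, h])
  have hW1c : HasCompactSupport W1 := by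
    have : W1 = deriv W := funext fun x => (hWd x).deriv.symm
    rw [this]; exact hWc.deriv
  have iW1 : Integrable W1 := cW1.integrable_of_hasCompactSupport hW1c
  have hW0 : ∫ x, W1 x = 0 := integral_eq_zero_of_hasDerivAt_of_integrable hWd iW1
    ((cont hWd).integrable_of_hasCompactSupport hWc)
  have if1 : Integrable fun x => f1 x ^ 2 :=
    (cf1.pow 2).integrable_of_hasCompactSupport (hf1c.mono fun x hx => by
      rw [Function.mem_support] at hx ⊢
      intro h
      exact hx (by simp [h]))
  have if2 : Integrable fun x => ψ x ^ 2 * |U x| ^ q := by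
    refine hUq.mono' ((by fun_prop : Continuous fun x => ψ x ^ 2).mul
      (continuous_abs_rpow hq0.le cU)).aestronglyMeasurable (Eventually.of_forall fun x => ?_)
    have h0 : 0 ≤ |U x| ^ q := Real.rpow_nonneg (abs_nonneg _) _
    rw [Real.norm_of_nonneg (mul_nonneg (sq_nonneg _) h0)]
    exact mul_le_of_le_one_left h0 (pow_le_one₀ (hψ01 x).1 (hψ01 x).2)
  have hpt : ∀ x, q * (ψ x ^ 2 * (U x * A x)) * (U2 x - (b1 x * U x + b x * U1 x)) ≤
      W1 x - 2 * (q - 1) / q * f1 x ^ 2 + q * (q - 1) / 2 * B ^ 2 * (ψ x ^ 2 * |U x| ^ q)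
        + (2 * q * B + 2 * |β| + 3) * κ * |U x| ^ q := by
    intro x
    -- Expanding `f1²` absorbs all but `-2ψψ'|U|^(q-2) U U'` of the diffusive cross terms. That
    -- remainder is `-(2/q)ψψ'(|U|^q)'`, which the last term of `W` turns into an exact derivative.
    -- Apart from `W1` and `f1²`, `U'` survives only in the quadratic form handled by Young's
    -- inequality.
    have e1 : q * (ψ x ^ 2 * (U x * A x)) * (U2 x - (b1 x * U x + b x * U1 x)) =
        W1 x - 2 * (q - 1) / q * f1 x ^ 2
        - q * (q - 1) / 2 * (ψ x ^ 2 * A x) * (U1 x ^ 2 - 2 * ((b x - β) * U x) * U1 x)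
        + (2 * q * (b x - β) * (ψ x * ψ1 x) + 2 * β * (ψ x * ψ1 x)
          + 2 * ψ1 x ^ 2 + 2 / q * (ψ x * ψ2 x)) * (A x * U x ^ 2) := by
      simp only [hW1, hf1, ← hEA]
      field_simp
      ring
    have hBx := abs_le.1 (hbB x)
    have h2 : -(U1 x ^ 2 - 2 * ((b x - β) * U x) * U1 x) ≤ B ^ 2 * U x ^ 2 := by
      have h3 : (b x - β) ^ 2 ≤ B ^ 2 := sq_le_sq' hBx.1 hBx.2
      nlinarith [sq_nonneg (U1 x - (b x - β) * U x),
        mul_le_mul_of_nonneg_right h3 (sq_nonneg (U x))]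
    have h4 : 0 ≤ q * (q - 1) / 2 * (ψ x ^ 2 * A x) :=
      mul_nonneg (by nlinarith) (mul_nonneg (sq_nonneg _) (hA0 x))
    have h5 := mul_le_mul_of_nonneg_left h2 h4
    have hψψ1 : |ψ x * ψ1 x| ≤ κ := by
      rw [abs_mul, abs_of_nonneg (hψ01 x).1]
      exact (mul_le_of_le_one_left (abs_nonneg _) (hψ01 x).2).trans (hκ1 x)
    have hψψ2 : |ψ x * ψ2 x| ≤ κ := by
      rw [abs_mul, abs_of_nonneg (hψ01 x).1]
      exact (mul_le_of_le_one_left (abs_nonneg _) (hψ01 x).2).trans (hκ2 x)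
    have hψ1sq : ψ1 x ^ 2 ≤ κ := by
      rw [← sq_abs]
      have := hκ1 x
      nlinarith [abs_nonneg (ψ1 x)]
    have h6 : (b x - β) * (ψ x * ψ1 x) ≤ B * κ :=
      (le_abs_self _).trans (by
        rw [abs_mul]
        exact mul_le_mul (hbB x) hψψ1 (abs_nonneg _) ((abs_nonneg _).trans (hbB x)))
    have h7 : β * (ψ x * ψ1 x) ≤ |β| * κ :=
      (le_abs_self _).trans (by
        rw [abs_mul]
        exact mul_le_mul_of_nonneg_left hψψ1 (abs_nonneg _))
    have h8 : 2 / q * (ψ x * ψ2 x) ≤ κ := by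
      have h9 : 2 / q ≤ 1 := (div_le_one hq0).2 hq
      have h10 : 0 ≤ 2 / q := by positivity
      calc 2 / q * (ψ x * ψ2 x) ≤ 2 / q * κ :=
            mul_le_mul_of_nonneg_left ((le_abs_self _).trans hψψ2) h10
        _ ≤ κ := mul_le_of_le_one_left hκ0 h9
    -- The `3` collects `2ψ'² ≤ 2κ`, valid as `κ ≤ 1`, and `(2/q)ψψ'' ≤ κ`, valid as `q ≥ 2`.
    have h11 : 2 * q * (b x - β) * (ψ x * ψ1 x) + 2 * β * (ψ x * ψ1 x)
          + 2 * ψ1 x ^ 2 + 2 / q * (ψ x * ψ2 x) ≤ (2 * q * B + 2 * |β| + 3) * κ := by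
      have := mul_le_mul_of_nonneg_left h6 (by linarith : 0 ≤ 2 * q)
      linarith
    have h12 := mul_le_mul_of_nonneg_right h11 (mul_nonneg (hA0 x) (sq_nonneg (U x)))
    rw [e1, hΦ]
    linarith
  have i1 : Integrable fun x => W1 x - 2 * (q - 1) / q * f1 x ^ 2 :=
    iW1.sub (if1.const_mul (2 * (q - 1) / q))
  have i2 : Integrable fun x => W1 x - 2 * (q - 1) / q * f1 x ^ 2
      + q * (q - 1) / 2 * B ^ 2 * (ψ x ^ 2 * |U x| ^ q) :=
    i1.add (if2.const_mul (q * (q - 1) / 2 * B ^ 2))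
  have iL : Integrable fun x =>
      q * (ψ x ^ 2 * (U x * A x)) * (U2 x - (b1 x * U x + b x * U1 x)) :=
    Continuous.integrable_of_hasCompactSupport (by fun_prop) (hψc.mono fun x hx => by
      rw [Function.mem_support] at hx ⊢
      intro h
      exact hx (by simp [h]))
  have hmain := integral_mono iL (i2.add (hUq.const_mul ((2 * q * B + 2 * |β| + 3) * κ))) hpt
  have hsum : ∫ x, (W1 x - 2 * (q - 1) / q * f1 x ^ 2
      + q * (q - 1) / 2 * B ^ 2 * (ψ x ^ 2 * |U x| ^ q)
        + (2 * q * B + 2 * |β| + 3) * κ * |U x| ^ q) =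
      - (2 * (q - 1) / q * ∫ x, f1 x ^ 2)
      + q * (q - 1) / 2 * B ^ 2 * (∫ x, ψ x ^ 2 * |U x| ^ q)
      + (2 * q * B + 2 * |β| + 3) * κ * ∫ x, |U x| ^ q := by
    rw [integral_add i2 (hUq.const_mul _), integral_add i1 (if2.const_mul _),
      integral_sub iW1 (if1.const_mul _), hW0, integral_const_mul, integral_const_mul,
      integral_const_mul, zero_sub]
  have hmain2 := hmain.trans hsum.le
  have hnash := nash_inequality hfd cf1 hfc
  simp only [hfsq] at hnash
  set y := ∫ x, ψ x ^ 2 * |U x| ^ q with hy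
  set D := ∫ x, f1 x ^ 2 with hD
  have hm : ∫ x, |f x| ≤ N := by
    refine le_trans (integral_mono
      ((cont hfd).abs.integrable_of_hasCompactSupport hfc.norm) hUi fun x => ?_) hUN
    simp only [hf]
    rw [abs_mul, hEU, abs_of_nonneg (hψ01 x).1]
    exact mul_le_of_le_one_left (Real.rpow_nonneg (abs_nonneg _) _) (hψ01 x).2
  have hD0 : 0 ≤ D := integral_nonneg fun x => sq_nonneg _
  have hm4 : (∫ x, |f x|) ^ 4 ≤ N ^ 4 :=
    pow_le_pow_left₀ (integral_nonneg fun x => abs_nonneg _) hm 4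
  have hnash2 : 16 * Real.pi ^ 2 * y ^ 3 / (27 * N ^ 4) ≤ D := by
    rw [div_le_iff₀ (by positivity)]
    have := mul_le_mul_of_nonneg_left hm4 (mul_nonneg (by norm_num : (0 : ℝ) ≤ 27) hD0)
    linarith
  have hB0 : 0 ≤ B := (abs_nonneg _).trans (hbB 0)
  have h13 := mul_le_mul_of_nonneg_left hnash2
    (div_nonneg (by linarith) hq0.le : 0 ≤ 2 * (q - 1) / q)
  have h14 : (2 * q * B + 2 * |β| + 3) * κ * ∫ x, |U x| ^ q ≤ (2 * q * B + 2 * |β| + 3) * κ * S :=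
    mul_le_mul_of_nonneg_left hUS (by positivity)
  have h15 : q * (q - 1) / 2 * y * (B ^ 2 - 64 * Real.pi ^ 2 / (27 * q ^ 2 * N ^ 4) * y ^ 2) =
      q * (q - 1) / 2 * B ^ 2 * y
        - 2 * (q - 1) / q * (16 * Real.pi ^ 2 * y ^ 3 / (27 * N ^ 4)) := by
    field_simp
    ring
  rw [h15]
  linarith

/-! ### A decay criterion and cutoff functions. -/

/-- If `f` decreases at rate at least `δ` wherever it exceeds `ℓ`, then it is eventually
at most `ℓ`, quantitatively. -/
theorem le_max_of_deriv_le_neg {f f' : ℝ → ℝ} {t₀ T ℓ δ : ℝ} (hT : t₀ ≤ T) (hδ : 0 ≤ δ)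
    (hf : ∀ t ∈ Icc t₀ T, HasDerivAt f (f' t) t)
    (hf' : ∀ t ∈ Icc t₀ T, ℓ < f t → f' t ≤ -δ) :
    f T ≤ max ℓ (f t₀ - δ * (T - t₀)) := by
  have hc : ContinuousOn f (Icc t₀ T) := fun t ht => (hf t ht).continuousAt.continuousWithinAt
  have decay : ∀ s ∈ Icc t₀ T, (∀ t ∈ Ioc s T, ℓ < f t) → f T ≤ f s - δ * (T - s) := by
    intro s hs h
    have hanti : AntitoneOn (fun t => f t + δ * t) (Icc s T) := by
      have hsub : Icc s T ⊆ Icc t₀ T := Icc_subset_Icc_left hs.1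
      refine antitoneOn_of_deriv_nonpos (convex_Icc _ _)
        ((hc.mono hsub).add (by fun_prop)) (fun t ht => ?_) fun t ht => ?_
      · rw [interior_Icc] at ht
        have hd := (hf t (hsub (Ioo_subset_Icc_self ht))).add ((hasDerivAt_id t).const_mul δ)
        exact hd.differentiableAt.differentiableWithinAt
      · rw [interior_Icc] at ht
        have hd := (hf t (hsub (Ioo_subset_Icc_self ht))).add ((hasDerivAt_id t).const_mul δ)
        have hd2 : deriv (fun t => f t + δ * t) t = f' t + δ * 1 := hd.deriv
        rw [hd2]
        have := hf' t (hsub (Ioo_subset_Icc_self ht)) (h t (Ioo_subset_Ioc_self ht))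
        linarith
    have := hanti (left_mem_Icc.2 hs.2) (right_mem_Icc.2 hs.2) hs.2
    simp only at this
    linarith
  by_cases hall : ∀ t ∈ Ioc t₀ T, ℓ < f t
  · exact (decay t₀ (left_mem_Icc.2 hT) hall).trans (le_max_right _ _)
  · push Not at hall
    obtain ⟨r, hr, hrl⟩ := hall
    set Z : Set ℝ := Icc t₀ T ∩ f ⁻¹' Iic ℓ with hZ
    have hZc : IsCompact Z :=
      isCompact_Icc.of_isClosed_subset (hc.preimage_isClosed_of_isClosed isClosed_Icc isClosed_Iic)
        inter_subset_left
    -- The last time at which `f ≤ ℓ`; after it the decay hypothesis applies throughout.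
    obtain ⟨s, hs⟩ := hZc.exists_isGreatest ⟨r, Ioc_subset_Icc_self hr, hrl⟩
    have h1 := decay s hs.1.1 fun t ht => by
      by_contra! hle
      exact ht.1.not_ge (hs.2 ⟨⟨hs.1.1.1.trans ht.1.le, ht.2⟩, hle⟩)
    have h2 : f s ≤ ℓ := hs.1.2
    have h3 : 0 ≤ δ * (T - s) := mul_nonneg hδ (sub_nonneg.2 hs.1.1.2)
    exact le_trans (by linarith) (le_max_left _ _)

/-- `C²` cutoff functions with arbitrarily small first and second derivatives. -/
theorem exists_cutoff {κ : ℝ} (hκ : 0 < κ) (R : ℝ) : ∃ ψ ψ1 ψ2 : ℝ → ℝ,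
    (∀ x, HasDerivAt ψ (ψ1 x) x) ∧ (∀ x, HasDerivAt ψ1 (ψ2 x) x) ∧ Continuous ψ2 ∧
    HasCompactSupport ψ ∧ (∀ x, ψ x ∈ Icc (0 : ℝ) 1) ∧ (∀ x, |ψ1 x| ≤ κ) ∧ (∀ x, |ψ2 x| ≤ κ) ∧
    ∀ x, |x| ≤ R → ψ x = 1 := by
  let χ : ContDiffBump (0 : ℝ) := ⟨1, 2, zero_lt_one, one_lt_two⟩
  have hχ2 : ContDiff ℝ 2 χ := χ.contDiff
  have hχ : ∀ x, HasDerivAt χ (deriv χ x) x := fun x =>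
    (hχ2.differentiable two_ne_zero x).hasDerivAt
  have hχ1c : ContDiff ℝ 1 (deriv χ) := by
    have : ContDiff ℝ (1 + 1) χ := hχ2
    exact (contDiff_succ_iff_deriv.1 this).2.2
  have hχ1 : ∀ x, HasDerivAt (deriv χ) (deriv (deriv χ) x) x := fun x =>
    (hχ1c.differentiable one_ne_zero x).hasDerivAt
  have hχ2c : Continuous (deriv (deriv χ)) := hχ1c.continuous_deriv le_rfl
  obtain ⟨C1, hC1⟩ := χ.hasCompactSupport.deriv.exists_bound_of_continuous hχ1c.continuous
  obtain ⟨C2, hC2⟩ := χ.hasCompactSupport.deriv.deriv.exists_bound_of_continuous hχ2c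
  set C := max C1 C2
  have hC0 : 0 ≤ C := ((norm_nonneg _).trans (hC1 0)).trans (le_max_left _ _)
  -- A fixed bump is dilated by `ρ`. Taking `ρ ≥ 1` lets the `ρ⁻²` of the second derivative be
  -- bounded by `ρ⁻¹`.
  set ρ : ℝ := max 1 (max R (C / κ)) with hρdef
  have hρ1 : 1 ≤ ρ := le_max_left _ _
  have hρR : R ≤ ρ := (le_max_left _ _).trans (le_max_right _ _)
  have hρC : C / κ ≤ ρ := (le_max_right _ _).trans (le_max_right _ _)
  have hρ : 0 < ρ := zero_lt_one.trans_le hρ1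
  have hCρ : C * ρ⁻¹ ≤ κ := by
    rw [← div_eq_mul_inv, div_le_iff₀ hρ]
    rw [div_le_iff₀ hκ] at hρC
    linarith
  have hlin : ∀ x : ℝ, HasDerivAt (fun x : ℝ => x * ρ⁻¹) ρ⁻¹ x := fun x => by
    simpa using (hasDerivAt_id' x).mul_const ρ⁻¹
  have hρi : 0 < ρ⁻¹ := inv_pos.2 hρ
  have hρi1 : ρ⁻¹ ≤ 1 := inv_le_one_of_one_le₀ hρ1
  refine ⟨fun x => χ (x * ρ⁻¹), fun x => deriv χ (x * ρ⁻¹) * ρ⁻¹,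
    fun x => deriv (deriv χ) (x * ρ⁻¹) * ρ⁻¹ * ρ⁻¹, fun x => (hχ _).comp x (hlin x),
    fun x => ((hχ1 _).comp x (hlin x)).mul_const _, by fun_prop, ?_, fun x => ⟨χ.nonneg, χ.le_one⟩,
    fun x => ?_, fun x => ?_, fun x hx => ?_⟩
  · exact χ.hasCompactSupport.comp_homeomorph (Homeomorph.mulRight₀ ρ⁻¹ hρi.ne')
  · rw [abs_mul, abs_of_pos hρi]
    exact (mul_le_mul_of_nonneg_right ((hC1 _).trans (le_max_left _ _)) hρi.le).trans hCρ
  · rw [abs_mul, abs_mul, abs_of_pos hρi]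
    refine le_trans ?_ hCρ
    refine le_trans (mul_le_of_le_one_right (by positivity) hρi1) ?_
    exact mul_le_mul_of_nonneg_right ((hC2 _).trans (le_max_right _ _)) hρi.le
  · refine χ.one_of_mem_closedBall ?_
    rw [Metric.mem_closedBall, Real.dist_0_eq_abs, abs_mul, abs_of_pos hρi, ← div_eq_mul_inv]
    exact (div_le_one hρ).2 (hx.trans hρR)

/-! ### Evolution of the `L^q` integral along a solution. -/

namespace AdvDiff

theorem IsAdvectionField.contDiff_slice {b : ℝ → ℝ → ℝ} (hb : IsAdvectionField b) {t : ℝ}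
    (ht : 0 ≤ t) : ContDiff ℝ 1 fun x => b x t := by
  have h : ContDiff ℝ 1 fun x : ℝ => ((x, t) : ℝ × ℝ) := by fun_prop
  exact contDiffOn_univ.1 (hb.contDiffOn.comp h.contDiffOn fun x _ => ⟨mem_univ _, ht⟩)

/-- The midpoint of the range of `b(·,t)`. -/
noncomputable def midRange (b : ℝ → ℝ → ℝ) (t : ℝ) : ℝ := ((⨆ x : ℝ, b x t) + ⨅ x : ℝ, b x t) / 2

theorem range_bounds {b : ℝ → ℝ → ℝ} {M t : ℝ} (hM : ∀ x, |b x t| ≤ M) :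
    BddAbove (range fun x => b x t) ∧ BddBelow (range fun x => b x t) :=
  ⟨⟨M, by rintro _ ⟨x, rfl⟩; exact (abs_le.1 (hM x)).2⟩,
    ⟨-M, by rintro _ ⟨x, rfl⟩; exact (abs_le.1 (hM x)).1⟩⟩

theorem abs_sub_midRange_le {b : ℝ → ℝ → ℝ} {M t : ℝ} (hM : ∀ x, |b x t| ≤ M) (x : ℝ) :
    |b x t - midRange b t| ≤ halfOsc b t := by
  have h1 := le_ciSup (range_bounds hM).1 x
  have h2 := ciInf_le (range_bounds hM).2 x
  unfold midRange halfOsc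
  rw [abs_le]
  constructor <;> linarith

/-- Keeps the drift constant in the cutoff error bounded uniformly in time. -/
theorem abs_midRange_le {b : ℝ → ℝ → ℝ} {M t : ℝ} (hM : ∀ x, |b x t| ≤ M) :
    |midRange b t| ≤ M := by
  have h1 : (⨆ x, b x t) ≤ M := ciSup_le fun x => (abs_le.1 (hM x)).2
  have h2 : -M ≤ ⨅ x, b x t := le_ciInf fun x => (abs_le.1 (hM x)).1
  have h3 := le_ciSup (range_bounds hM).1 0
  have h4 := ciInf_le (range_bounds hM).2 0
  have h5 := abs_le.1 (hM 0)
  unfold midRange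
  rw [abs_le]
  constructor <;> linarith

theorem halfOsc_le {b : ℝ → ℝ → ℝ} {M t : ℝ} (hM : ∀ x, |b x t| ≤ M) : halfOsc b t ≤ M := by
  have h1 : (⨆ x, b x t) ≤ M := ciSup_le fun x => (abs_le.1 (hM x)).2
  have h2 : -M ≤ ⨅ x, b x t := le_ciInf fun x => (abs_le.1 (hM x)).1
  unfold halfOsc
  linarith

/-- Differentiation in time of the localized `L^q` integral of a solution. -/
theorem IsSolution.hasDerivAt_localized {b : ℝ → ℝ → ℝ} {u₀ : ℝ → ℝ} {u : ℝ → ℝ → ℝ}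
    (hu : IsSolution b u₀ u) {q : ℝ} (hq : 2 ≤ q) {ψ : ℝ → ℝ} (hψ : Continuous ψ)
    (hψc : HasCompactSupport ψ) {t : ℝ} (ht : 0 < t) :
    HasDerivAt (fun s => ∫ x, ψ x ^ 2 * |u x s| ^ q)
      (∫ x, q * (ψ x ^ 2 * (u x t * |u x t| ^ (q - 2))) * deriv (fun s => u x s) t) t := by
  have hpos : ∀ s ∈ Icc (t / 2) (3 * t / 2), 0 < s := fun s hs => by linarith [hs.1]
  have hcu : ∀ s, 0 < s → Continuous fun x => u x s := fun s hs => (hu.contDiff_space s hs).continuous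
  have hq2 : 0 ≤ q - 2 := by linarith
  set F' : ℝ → ℝ → ℝ := fun s x =>
    q * (ψ x ^ 2 * (u x s * |u x s| ^ (q - 2))) * deriv (fun s => u x s) s with hF'
  have hF'c : ContinuousOn (fun z : ℝ × ℝ => F' z.2 z.1) (univ ×ˢ Ioi 0) := by
    have h1 := hu.continuousOn_u
    have h2 : ContinuousOn (fun z : ℝ × ℝ => |u z.1 z.2| ^ (q - 2)) (univ ×ˢ Ioi 0) :=
      h1.abs.rpow_const fun _ _ => Or.inr hq2
    have h3 : ContinuousOn (fun z : ℝ × ℝ => ψ z.1 ^ 2) (univ ×ˢ Ioi 0) :=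
      (by fun_prop : Continuous fun z : ℝ × ℝ => ψ z.1 ^ 2).continuousOn
    exact (continuousOn_const.mul (h3.mul (h1.mul h2))).mul hu.continuousOn_u_t
  -- The time window stays away from `0`, where `u_t` need not be continuous; compactness in both
  -- variables gives the dominating constant.
  obtain ⟨C, hC⟩ := (hψc.isCompact.prod (isCompact_Icc (a := t / 2) (b := 3 * t / 2))).exists_bound_of_continuousOn
    (hF'c.mono fun z hz => ⟨mem_univ _, hpos z.2 hz.2⟩)
  have hslice : Continuous (F' t) := by
    have : ContinuousOn (fun x : ℝ => ((x, t) : ℝ × ℝ)) univ := by fun_prop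
    exact continuousOn_univ.1 (hF'c.comp this fun x _ => ⟨mem_univ _, ht⟩)
  have hcF : ∀ s, 0 < s → Continuous fun x => ψ x ^ 2 * |u x s| ^ q := fun s hs =>
    (hψ.pow 2).mul (continuous_abs_rpow (by linarith) (hcu s hs))
  refine (hasDerivAt_integral_of_dominated_loc_of_deriv_le (F := fun s x => ψ x ^ 2 * |u x s| ^ q)
    (F' := F') (s := Icc (t / 2) (3 * t / 2)) (bound := (tsupport ψ).indicator fun _ => C)
    (Icc_mem_nhds (by linarith) (by linarith)) ?_ ?_ hslice.aestronglyMeasurable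
    (Eventually.of_forall fun x s hs => ?_) ?_ (Eventually.of_forall fun x s hs => ?_)).2
  · filter_upwards [Ioi_mem_nhds ht] with s hs
    exact (hcF s hs).aestronglyMeasurable
  · exact (hcF t ht).integrable_of_hasCompactSupport (hψc.mono fun x hx => by
      rw [Function.mem_support] at hx ⊢
      intro h
      exact hx (by simp [h]))
  · by_cases hx : x ∈ tsupport ψ
    · rw [indicator_of_mem hx]
      exact hC (x, s) ⟨hx, hs⟩
    · rw [indicator_of_notMem hx]
      simp [hF', image_eq_zero_of_notMem_tsupport hx]
  · exact (integrable_indicator_iff hψc.isCompact.measurableSet).2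
      (integrableOn_const hψc.isCompact.measure_lt_top.ne)
  · have h1 := (hu.differentiable_time x s (hpos s hs)).hasDerivAt
    have h2 := (hasDerivAt_abs_rpow (u x s) (by linarith : 1 < q)).comp s h1
    refine (h2.const_mul (ψ x ^ 2)).congr_deriv ?_
    simp only [hF']
    ring

/-- If `∫ |u|^{q/2} ≤ N` and the half-oscillation of `b` is at most `B` for large times, then
`∫ |u|^q` is eventually below any level exceeding the threshold of the energy inequality. -/
theorem IsSolution.eventually_integral_le {b : ℝ → ℝ → ℝ} (hb : IsAdvectionField b) {u₀ : ℝ → ℝ}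
    {u : ℝ → ℝ → ℝ} (hu : IsSolution b u₀ u) {q : ℝ} (hq : 2 ≤ q) {t₀ B N ℓ : ℝ} (ht₀ : 0 < t₀)
    (hB : ∀ t, t₀ ≤ t → halfOsc b t ≤ B) (hN : 0 < N)
    (hui : ∀ t, t₀ ≤ t → Integrable fun x => |u x t| ^ (q / 2))
    (huN : ∀ t, t₀ ≤ t → ∫ x, |u x t| ^ (q / 2) ≤ N) (hℓ : 0 < ℓ)
    (hBℓ : B ^ 2 < 64 * Real.pi ^ 2 / (27 * q ^ 2 * N ^ 4) * ℓ ^ 2) :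
    ∀ᶠ t in atTop, (Integrable fun x => |u x t| ^ q) ∧ ∫ x, |u x t| ^ q ≤ ℓ := by
  obtain ⟨M, hM⟩ := hb.bounded
  have hM0 : 0 ≤ M := (abs_nonneg _).trans (hM 0 0 le_rfl)
  have hq0 : 0 < q := by linarith
  have hcu : ∀ s, 0 < s → Continuous fun x => u x s := fun s hs => (hu.contDiff_space s hs).continuous
  have hbd : ∀ T, t₀ ≤ T → ∃ S, 0 ≤ S ∧ ∀ t ∈ Icc t₀ T, (Integrable fun x => |u x t| ^ q) ∧
      ∫ x, |u x t| ^ q ≤ S := by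
    intro T hT
    obtain ⟨V, hV⟩ := hu.bounded_strip T (ht₀.trans_le hT)
    have hV0 : 0 ≤ V := (abs_nonneg _).trans (hV 0 T ⟨by linarith, le_rfl⟩)
    refine ⟨V ^ (q / 2) * N, by positivity, fun t ht => ?_⟩
    have hpt : ∀ x, |u x t| ^ q ≤ V ^ (q / 2) * |u x t| ^ (q / 2) := fun x => by
      have : |u x t| ^ q = |u x t| ^ (q / 2) * |u x t| ^ (q / 2) := by
        rw [← Real.rpow_add_of_nonneg (abs_nonneg _) (by linarith) (by linarith), add_halves]
      rw [this]
      exact mul_le_mul_of_nonneg_right (Real.rpow_le_rpow (abs_nonneg _)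
        (hV x t ⟨by linarith [ht.1], ht.2⟩) (by linarith)) (Real.rpow_nonneg (abs_nonneg _) _)
    have hi : Integrable fun x => |u x t| ^ q := by
      refine ((hui t ht.1).const_mul (V ^ (q / 2))).mono'
        (continuous_abs_rpow hq0.le (hcu t (ht₀.trans_le ht.1))).aestronglyMeasurable
        (Eventually.of_forall fun x => ?_)
      rw [Real.norm_of_nonneg (Real.rpow_nonneg (abs_nonneg _) _)]
      exact hpt x
    refine ⟨hi, (integral_mono hi ((hui t ht.1).const_mul _) hpt).trans ?_⟩
    rw [integral_const_mul]
    exact mul_le_mul_of_nonneg_left (huN t ht.1) (by positivity)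
  set γ := 64 * Real.pi ^ 2 / (27 * q ^ 2 * N ^ 4) with hγ
  have hγ0 : 0 ≤ γ := by positivity
  -- Half of the decay rate available at level `ℓ`; the other half pays for the cutoff error.
  set δ := q * (q - 1) / 2 * ℓ * (γ * ℓ ^ 2 - B ^ 2) / 2 with hδ
  have hδ0 : 0 < δ := by
    have h1 : 0 < q * (q - 1) := mul_pos hq0 (by linarith)
    have h2 : 0 < γ * ℓ ^ 2 - B ^ 2 := sub_pos.2 hBℓ
    positivity
  set F0 := ∫ x, |u x t₀| ^ q with hF0
  filter_upwards [eventually_ge_atTop (max t₀ (t₀ + F0 / δ))] with T hT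
  have hT0 : t₀ ≤ T := (le_max_left _ _).trans hT
  have hTF : F0 ≤ δ * (T - t₀) := by
    have := (le_max_right _ _).trans hT
    rw [mul_comm, ← div_le_iff₀ hδ0]
    linarith
  obtain ⟨S, hS0, hS⟩ := hbd T hT0
  refine ⟨(hS T ⟨hT0, le_rfl⟩).1, ?_⟩
  have hB0 : 0 ≤ B :=
    ((abs_nonneg _).trans (abs_sub_midRange_le (fun x => hM x t₀ ht₀.le) 0)).trans (hB t₀ le_rfl)
  set C := 2 * q * B + 2 * M + 3 with hC
  have hC0 : 0 ≤ C := by positivity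
  -- The bound `S` on `∫ |u|^q` may grow with `T`, so `κ` is chosen after `T`. This is harmless
  -- because `δ` and `F0`, which fix the waiting time, depend on neither `T` nor the cutoff.
  set κ := min 1 (δ / (C * S + 1)) with hκ
  have hκ0 : 0 < κ := by positivity
  have hκS : C * κ * S ≤ δ := by
    have h1 : κ * (C * S + 1) ≤ δ := (le_div_iff₀ (by positivity)).1 (min_le_right _ _)
    nlinarith
  have hloc : ∀ R : ℝ, 0 ≤ R → ∫ x in (-R)..R, |u x T| ^ q ≤ ℓ := by
    intro R hR
    obtain ⟨ψ, ψ1, ψ2, hψ, hψ1, hψ2, hψc, hψ01, hκ1, hκ2, hψR⟩ := exists_cutoff hκ0 R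
    have cψ : Continuous ψ := continuous_iff_continuousAt.2 fun x => (hψ x).continuousAt
    have hle : ∀ x t, ψ x ^ 2 * |u x t| ^ q ≤ |u x t| ^ q := fun x t =>
      mul_le_of_le_one_left (Real.rpow_nonneg (abs_nonneg _) _)
        (pow_le_one₀ (hψ01 x).1 (hψ01 x).2)
    have hnn : ∀ x t, 0 ≤ ψ x ^ 2 * |u x t| ^ q := fun x t =>
      mul_nonneg (sq_nonneg _) (Real.rpow_nonneg (abs_nonneg _) _)
    have hψi : ∀ t ∈ Icc t₀ T, Integrable fun x => ψ x ^ 2 * |u x t| ^ q := fun t ht =>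
      (hS t ht).1.mono' ((cψ.pow 2).mul
        (continuous_abs_rpow hq0.le (hcu t (ht₀.trans_le ht.1)))).aestronglyMeasurable
        (Eventually.of_forall fun x => by
          rw [Real.norm_of_nonneg (hnn x t)]; exact hle x t)
    have hode := le_max_of_deriv_le_neg (f := fun t => ∫ x, ψ x ^ 2 * |u x t| ^ q)
      (ℓ := ℓ) hT0 hδ0.le
      (fun t ht => hu.hasDerivAt_localized hq cψ hψc (ht₀.trans_le ht.1)) fun t ht hlt => by
        have htpos : 0 < t := ht₀.trans_le ht.1
        have hu2 : ContDiff ℝ (1 + 1) fun x => u x t := hu.contDiff_space t htpos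
        have hu1 := (contDiff_succ_iff_deriv.1 hu2).2.2
        have hb1 := hb.contDiff_slice htpos.le
        have hU : ∀ x, HasDerivAt (fun x => u x t) (deriv (fun x => u x t) x) x := fun x =>
          (hu2.differentiable (by norm_num) x).hasDerivAt
        have hU1 : ∀ x, HasDerivAt (deriv fun x => u x t) (deriv (deriv fun x => u x t) x) x :=
          fun x => (hu1.differentiable one_ne_zero x).hasDerivAt
        have hbd : ∀ x, HasDerivAt (fun x => b x t) (deriv (fun x => b x t) x) x := fun x =>
          (hb1.differentiable one_ne_zero x).hasDerivAt
        have heq : ∀ x, deriv (fun s => u x s) t = deriv (deriv fun x => u x t) x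
            - (deriv (fun x => b x t) x * u x t + b x t * deriv (fun x => u x t) x) := fun x => by
          have h1 := hu.equation x t htpos
          have h2 : deriv (fun y => b y t * u y t) x = _ := ((hbd x).mul (hU x)).deriv
          rw [h2] at h1
          linarith
        simp only [heq]
        have hen := localized_energy_le hq (β := midRange b t) (B := B) hU hU1
          (hu1.continuous_deriv le_rfl) hbd (hb1.continuous_deriv le_rfl)
          (fun x => (abs_sub_midRange_le (fun x => hM x t htpos.le) x).trans (hB t ht.1))
          hψ hψ1 hψ2 hψc hψ01 hκ1 hκ2 (min_le_left _ _) hN (hui t ht.1) (huN t ht.1)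
          (hS t ht).1 (hS t ht).2
        refine hen.trans ?_
        rw [← hγ]
        set y := ∫ x, ψ x ^ 2 * |u x t| ^ q with hy
        have hβ : |midRange b t| ≤ M := abs_midRange_le fun x => hM x t htpos.le
        have herr : (2 * q * B + 2 * |midRange b t| + 3) * κ * S ≤ C * κ * S := by
          rw [hC]
          gcongr
        have hyl : ℓ < y := hlt
        have h3 : γ * ℓ ^ 2 - B ^ 2 ≤ γ * y ^ 2 - B ^ 2 :=
          sub_le_sub_right (mul_le_mul_of_nonneg_left
            (pow_le_pow_left₀ hℓ.le hyl.le 2) hγ0) _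
        -- Above the threshold both factors of `y (γy² - B²)` increase, so the rate at `ℓ` is a
        -- lower bound for all `y > ℓ`.
        have h4 : ℓ * (γ * ℓ ^ 2 - B ^ 2) ≤ y * (γ * y ^ 2 - B ^ 2) :=
          mul_le_mul hyl.le h3 (sub_nonneg.2 hBℓ.le) (hℓ.trans hyl).le
        have h5 := mul_le_mul_of_nonneg_left h4
          (div_nonneg (mul_nonneg hq0.le (by linarith)) zero_le_two : 0 ≤ q * (q - 1) / 2)
        have h6 : q * (q - 1) / 2 * (ℓ * (γ * ℓ ^ 2 - B ^ 2)) = 2 * δ := by rw [hδ]; ring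
        linarith
    have hstart : ∫ x, ψ x ^ 2 * |u x t₀| ^ q ≤ F0 :=
      integral_mono (hψi t₀ ⟨le_rfl, hT0⟩) (hS t₀ ⟨le_rfl, hT0⟩).1 fun x => hle x t₀
    have hend : ∫ x, ψ x ^ 2 * |u x T| ^ q ≤ ℓ :=
      hode.trans (max_le le_rfl (by linarith))
    refine le_trans ?_ hend
    rw [intervalIntegral.integral_of_le (by linarith)]
    have hcongr : ∫ x in Ioc (-R) R, |u x T| ^ q = ∫ x in Ioc (-R) R, ψ x ^ 2 * |u x T| ^ q :=
      setIntegral_congr_fun measurableSet_Ioc fun x hx => by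
        simp [hψR x (abs_le.2 ⟨hx.1.le, hx.2⟩)]
    rw [hcongr]
    exact setIntegral_le_integral (hψi T ⟨hT0, le_rfl⟩) (Eventually.of_forall fun x => hnn x T)
  refine le_of_tendsto (intervalIntegral_tendsto_integral (hS T ⟨hT0, le_rfl⟩).1
    tendsto_neg_atTop_atBot tendsto_id) ?_
  filter_upwards [eventually_ge_atTop 0] with R hR using hloc R hR

end AdvDiff

/-! ### From integrals to norms and upper limits. -/

namespace AdvDiff

theorem mul_le_mulTop (a c : ℝ≥0∞) : a * c ≤ mulTop a c := by
  unfold mulTop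
  split_ifs
  · exact le_top
  · exact le_rfl

theorem mulTop_top (a : ℝ≥0∞) : mulTop a ∞ = ∞ := by
  unfold mulTop
  by_cases h : a = 0
  · simp [h]
  · simp [h, ENNReal.mul_top h]

theorem limsupHalfOsc_ne_top {b : ℝ → ℝ → ℝ} (hb : IsAdvectionField b) :
    limsupHalfOsc b ≠ ∞ := by
  obtain ⟨M, hM⟩ := hb.bounded
  refine ne_top_of_le_ne_top (ENNReal.ofReal_ne_top (r := M)) (limsup_le_of_le ?_ ?_)
  · isBoundedDefault
  · filter_upwards [eventually_ge_atTop 0] with t ht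
    exact ENNReal.ofReal_le_ofReal (halfOsc_le fun x => hM x t ht)

theorem integrable_rpow_and_integral_le {f : ℝ → ℝ} (hf : Continuous f) {r n : ℝ} (hr : 0 < r)
    (hn : 0 ≤ n) (h : eLpNorm f (ENNReal.ofReal r) volume ≤ ENNReal.ofReal n) :
    (Integrable fun x => |f x| ^ r) ∧ ∫ x, |f x| ^ r ≤ n ^ r := by
  have hr0 : ENNReal.ofReal r ≠ 0 := by simpa using hr
  have hL : MemLp f (ENNReal.ofReal r) volume :=
    ⟨hf.aestronglyMeasurable, h.trans_lt ENNReal.ofReal_lt_top⟩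
  have hi := hL.integrable_norm_rpow hr0 ENNReal.ofReal_ne_top
  rw [hL.eLpNorm_eq_integral_rpow_norm hr0 ENNReal.ofReal_ne_top,
    ENNReal.ofReal_le_ofReal_iff hn] at h
  simp only [ENNReal.toReal_ofReal hr.le, Real.norm_eq_abs] at hi h
  refine ⟨hi, ?_⟩
  have h0 : 0 ≤ ∫ x, |f x| ^ r := integral_nonneg fun x => Real.rpow_nonneg (abs_nonneg _) _
  have := Real.rpow_le_rpow (Real.rpow_nonneg h0 _) h hr.le
  rwa [← Real.rpow_mul h0, inv_mul_cancel₀ hr.ne', Real.rpow_one] at this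

theorem eLpNorm_le_of_integral_le {f : ℝ → ℝ} (hf : Continuous f) {r ℓ : ℝ} (hr : 0 < r)
    (hi : Integrable fun x => |f x| ^ r) (h : ∫ x, |f x| ^ r ≤ ℓ) :
    eLpNorm f (ENNReal.ofReal r) volume ≤ ENNReal.ofReal (ℓ ^ (1 / r)) := by
  have hr0 : ENNReal.ofReal r ≠ 0 := by simpa using hr
  have hL : MemLp f (ENNReal.ofReal r) volume := by
    rw [← integrable_norm_rpow_iff hf.aestronglyMeasurable hr0 ENNReal.ofReal_ne_top]
    simpa only [ENNReal.toReal_ofReal hr.le, Real.norm_eq_abs] using hi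
  rw [hL.eLpNorm_eq_integral_rpow_norm hr0 ENNReal.ofReal_ne_top]
  simp only [ENNReal.toReal_ofReal hr.le, Real.norm_eq_abs, one_div]
  exact ENNReal.ofReal_le_ofReal (Real.rpow_le_rpow
    (integral_nonneg fun x => Real.rpow_nonneg (abs_nonneg _) _) h (inv_nonneg.2 hr.le))

theorem nashConst_cube : nashConst ^ 3 = 3 * √3 / (4 * Real.pi) := by
  unfold nashConst
  rw [← Real.rpow_natCast, ← Real.rpow_mul (by positivity)]
  norm_num

/-- The bound for strictly larger values of the two upper limits. -/
theorem IsSolution.limsupNorm_le_of_lt {b : ℝ → ℝ → ℝ} (hb : IsAdvectionField b) {u₀ : ℝ → ℝ}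
    {u : ℝ → ℝ → ℝ} (hu : IsSolution b u₀ u) {q : ℝ} (hq : 2 ≤ q) {B n ε : ℝ} (hB0 : 0 ≤ B)
    (hn0 : 0 < n) (hε : 0 < ε) (hB : limsupHalfOsc b < ENNReal.ofReal B)
    (hn : limsupNorm u (q / 2) < ENNReal.ofReal n) :
    limsupNorm u q ≤ ENNReal.ofReal ((q / 2 * nashConst ^ 3 * B * n ^ q + ε) ^ (1 / q)) := by
  have hq0 : 0 < q := by linarith
  have hev1 := eventually_lt_of_limsup_lt hB
  have hev2 := eventually_lt_of_limsup_lt hn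
  obtain ⟨t₀, ht₀⟩ := eventually_atTop.1 (hev1.and hev2)
  have hcu : ∀ s, 0 < s → Continuous fun x => u x s := fun s hs => (hu.contDiff_space s hs).continuous
  have hint : ∀ t, max t₀ 1 ≤ t → (Integrable fun x => |u x t| ^ (q / 2)) ∧
      ∫ x, |u x t| ^ (q / 2) ≤ n ^ (q / 2) := fun t ht =>
    integrable_rpow_and_integral_le
      (hcu t (zero_lt_one.trans_le ((le_max_right _ _).trans ht))) (half_pos hq0) hn0.le
      (ht₀ t ((le_max_left _ _).trans ht)).2.le
  rw [nashConst_cube]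
  set ℓ := q / 2 * (3 * √3 / (4 * Real.pi)) * B * n ^ q + ε with hℓ
  have hθ0 : 0 ≤ q / 2 * (3 * √3 / (4 * Real.pi)) * B * n ^ q := by positivity
  have hev := hu.eventually_integral_le hb hq (t₀ := max t₀ 1) (B := B) (N := n ^ (q / 2)) (ℓ := ℓ)
    (by positivity)
    (fun t ht => (ENNReal.ofReal_le_ofReal_iff hB0).1 (ht₀ t ((le_max_left _ _).trans ht)).1.le)
    (by positivity) (fun t ht => (hint t ht).1) (fun t ht => (hint t ht).2)
    (by positivity) (by
      -- At `ε = 0` the level `ℓ` is exactly the equilibrium of the differential inequality; the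
      -- added `ε` makes the threshold condition strict.
      have hN : (n ^ (q / 2)) ^ 4 = (n ^ q) ^ 2 := by
        rw [← Real.rpow_natCast, ← Real.rpow_natCast, ← Real.rpow_mul hn0.le,
          ← Real.rpow_mul hn0.le]
        congr 1
        push_cast
        ring
      have h3 : √3 ^ 2 = (3 : ℝ) := Real.sq_sqrt (by norm_num)
      have hnq : 0 < n ^ q := by positivity
      have hpi := Real.pi_pos
      calc B ^ 2 = 64 * Real.pi ^ 2 / (27 * q ^ 2 * (n ^ (q / 2)) ^ 4)
            * (q / 2 * (3 * √3 / (4 * Real.pi)) * B * n ^ q) ^ 2 := by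
            rw [hN]
            field_simp
            rw [h3]
            ring
        _ < _ := by
          refine mul_lt_mul_of_pos_left ?_ (by positivity)
          exact pow_lt_pow_left₀ (by linarith) hθ0 two_ne_zero)
  refine limsup_le_of_le (by isBoundedDefault) ?_
  filter_upwards [hev, eventually_gt_atTop 0] with t ht htpos
  exact eLpNorm_le_of_integral_le (hcu t htpos) hq0 ht.1 ht.2

end AdvDiff

theorem theorem3p1 (b : ℝ → ℝ → ℝ) (hb : AdvDiff.IsAdvectionField b)
    (p₀ : ℝ) (hp₀ : 1 ≤ p₀)
    (u₀ : ℝ → ℝ) (hu₀ : MemLp u₀ (ENNReal.ofReal p₀) volume) (hu₀' : MemLp u₀ ∞ volume)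
    (u : ℝ → ℝ → ℝ) (hu : AdvDiff.IsSolution b u₀ u)
    (q : ℝ) (hq : 2 * p₀ ≤ q) :
    AdvDiff.limsupNorm u q ≤
      AdvDiff.mulTop
        (ENNReal.ofReal ((q / 2 * AdvDiff.nashConst ^ 3) ^ (1 / q))
          * AdvDiff.limsupHalfOsc b ^ (1 / q))
        (AdvDiff.limsupNorm u (q / 2)) := by
  have hq2 : 2 ≤ q := by linarith
  have hq0 : 0 < q := by linarith
  -- The convention `0 · ∞ = ∞` makes an infinite `L^(q/2)` upper limit trivial, whatever the
  -- oscillation of `b`.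
  by_cases hX : AdvDiff.limsupNorm u (q / 2) = ∞
  · rw [hX, AdvDiff.mulTop_top]
    exact le_top
  refine le_trans ?_ (AdvDiff.mul_le_mulTop _ _)
  have hA := AdvDiff.limsupHalfOsc_ne_top hb
  set a := (AdvDiff.limsupHalfOsc b).toReal with ha
  set n := (AdvDiff.limsupNorm u (q / 2)).toReal with hn
  have ha0 : 0 ≤ a := ENNReal.toReal_nonneg
  have hn0 : 0 ≤ n := ENNReal.toReal_nonneg
  have hC0 : 0 ≤ q / 2 * AdvDiff.nashConst ^ 3 := by
    rw [AdvDiff.nashConst_cube]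
    positivity
  have hrhs : ENNReal.ofReal ((q / 2 * AdvDiff.nashConst ^ 3) ^ (1 / q))
      * AdvDiff.limsupHalfOsc b ^ (1 / q) * AdvDiff.limsupNorm u (q / 2) =
      ENNReal.ofReal ((q / 2 * AdvDiff.nashConst ^ 3 * (a + 0) * (n + 0) ^ q + 0) ^ (1 / q)) := by
    rw [add_zero, add_zero, add_zero]
    generalize q / 2 * AdvDiff.nashConst ^ 3 = C at hC0
    rw [Real.mul_rpow (mul_nonneg hC0 ha0) (by positivity), Real.mul_rpow hC0 ha0, ← Real.rpow_mul hn0, mul_one_div_cancel hq0.ne', Real.rpow_one,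
      ENNReal.ofReal_mul (by positivity), ENNReal.ofReal_mul (by positivity),
      ← ENNReal.ofReal_rpow_of_nonneg ha0 (by positivity), ENNReal.ofReal_toReal hA,
      ENNReal.ofReal_toReal hX]
  rw [hrhs]
  have hlim : Tendsto (fun ε : ℝ => ENNReal.ofReal
      ((q / 2 * AdvDiff.nashConst ^ 3 * (a + ε) * (n + ε) ^ q + ε) ^ (1 / q))) (𝓝[>] 0)
      (𝓝 (ENNReal.ofReal
        ((q / 2 * AdvDiff.nashConst ^ 3 * (a + 0) * (n + 0) ^ q + 0) ^ (1 / q)))) := by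
    refine Tendsto.mono_left (Continuous.tendsto (ENNReal.continuous_ofReal.comp ?_) 0)
      nhdsWithin_le_nhds
    refine Continuous.rpow_const ?_ fun _ => Or.inr (by positivity)
    have : Continuous fun ε : ℝ => (n + ε) ^ q :=
      (continuous_const.add continuous_id).rpow_const fun _ => Or.inr hq0.le
    fun_prop
  -- Both upper limits are replaced by the strict majorants `a + ε` and `n + ε`, positive even if a
  -- limit vanishes, before `ε` tends to `0`.
  refine ge_of_tendsto hlim ?_
  filter_upwards [self_mem_nhdsWithin] with ε hε
  have hε0 : 0 < ε := hε
  refine hu.limsupNorm_le_of_lt hb hq2 (by positivity) (by positivity) hε0 ?_ ?_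
  · rw [ENNReal.lt_ofReal_iff_toReal_lt hA]
    linarith
  · rw [ENNReal.lt_ofReal_iff_toReal_lt hX]
    linarith
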